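/- (Conjugacy Lemma for Extensions.) Let $X=[0,1]$ and $Z=[0,1]\times[0,1]$ carry Lebesgue measure $m$, and let $\pi:Z\to X$ be the projection onto the first coordinate. Let $\mathcal G(X)$, $\mathcal G(Z)$ be the sets of invertible measure-preserving transformations of $X$, $Z$ (invertibility, and equality of transformations, being understood up to null sets), and let $\mathcal G_X$ be the set of $T\in\mathcal G(Z)$ which extend some $T'\in\mathcal G(X)$, i.e. $\pi\circ T=T'\circ\pi$ almost everywhere; this $T'$ is unique up to null sets. A transformation $R\in\mathcal G(X)$ is antiperiodic if for every $n\ge1$ one has $R^n x\ne x$ for almost every $x\in X$. A dyadic square of rank $k$ is a product $[\frac{i}{2^k},\frac{i+1}{2^k}]\times[\frac{j}{2^k},\frac{j+1}{2^k}]$ with $0\le i,j<2^k$, and a dyadic set is a finite union of dyadic squares. Let $T,T_0\in\mathcal G_X$ be such that $T_0'$ is antiperiodic, let $\varepsilon>0$, let $D_1,\dots,D_N$ be dyadic sets, and let $$N_\varepsilon(T)=\{V\in\mathcal G_X:\ m(VD_i\,\triangle\,TD_i)<\varepsilon,\ i=1,\dots,N\}$$ be the corresponding dyadic neighborhood of $T$.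 Then there exists $S\in\mathcal G_X$ such that $S^{-1}T_0S\in N_\varepsilon(T)$. -/

import Mathlib

open MeasureTheory
open scoped unitInterval symmDiff

/-- An invertible measure-preserving transformation of `(α, μ)`, in the sense of "modulo null sets":
a measure-preserving map together with a measure-preserving inverse up to null sets. Two such
transformations represent the same one when they agree almost everywhere; all the notions below
are insensitive to changing a transformation (or its inverse) on a null set. -/
structure InvTransf {α : Type*} [MeasurableSpace α] (μ : Measure α) where
  toFun : α → α
  invFun : α → α
  measurePreserving_toFun : MeasurePreserving toFun μ μ
  measurePreserving_invFun : MeasurePreserving invFun μ μ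
  left_inv : ∀ᵐ x ∂μ, invFun (toFun x) = x
  right_inv : ∀ᵐ x ∂μ, toFun (invFun x) = x

namespace InvTransf

variable {α : Type*} [MeasurableSpace α] {μ : Measure α}

instance : CoeFun (InvTransf μ) (fun _ => α → α) := ⟨toFun⟩

/-- The inverse transformation `T⁻¹`. -/
instance : Inv (InvTransf μ) where
  inv T :=
    { toFun := T.invFun
      invFun := T.toFun
      measurePreserving_toFun := T.measurePreserving_invFun
      measurePreserving_invFun := T.measurePreserving_toFun
      left_inv := T.right_inv
      right_inv := T.left_inv }

/-- The composition `S * T = S ∘ T` (first `T`, then `S`). -/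
instance : Mul (InvTransf μ) where
  mul S T :=
    { toFun := S.toFun ∘ T.toFun
      invFun := T.invFun ∘ S.invFun
      measurePreserving_toFun := S.measurePreserving_toFun.comp T.measurePreserving_toFun
      measurePreserving_invFun := T.measurePreserving_invFun.comp S.measurePreserving_invFun
      left_inv := by
        filter_upwards [T.left_inv,
          T.measurePreserving_toFun.quasiMeasurePreserving.ae S.left_inv] with x h1 h2
        simp only [Function.comp_apply, h2, h1]
      right_inv := by
        filter_upwards [S.right_inv,
          S.measurePreserving_invFun.quasiMeasurePreserving.ae T.right_inv] with x h1 h2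
        simp only [Function.comp_apply, h2, h1] }

/-- The image `T E`, as the preimage of `E` under the inverse. For a bijection with inverse
`T.invFun` this is literally `T '' E`; in general it is the version of the image that is
measurable for measurable `E` and well defined up to null sets. -/
def image (T : InvTransf μ) (E : Set α) : Set α := T.invFun ⁻¹' E

/-- `T` is antiperiodic: almost no point is periodic. -/
def Antiperiodic (T : InvTransf μ) : Prop :=
  ∀ n : ℕ, 0 < n → ∀ᵐ x ∂μ, T.toFun^[n] x ≠ x

end InvTransf

/-- `𝒢(X)`: invertible measure-preserving transformations of the unit interval with Lebesgue
measure. -/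
abbrev GInterval : Type := InvTransf (volume : Measure I)

/-- `𝒢(Z)`: invertible measure-preserving transformations of the unit square `Z = X × X` with
(two-dimensional) Lebesgue measure. -/
abbrev GSquare : Type := InvTransf (volume : Measure (I × I))

/-- `T` extends `T'` through the projection `π : Z → X` onto the first coordinate: `π ∘ T = T' ∘ π`
almost everywhere. -/
def Extends (T : GSquare) (T' : GInterval) : Prop :=
  ∀ᵐ z ∂(volume : Measure (I × I)), (T z).1 = T' z.1

/-- `𝒢_X`: the transformations of the square that extend some invertible measure-preserving
transformation of the interval. -/
def GX : Set GSquare := {T | ∃ T' : GInterval, Extends T T'}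

/-- The `i`-th dyadic interval `[i / 2 ^ k, (i + 1) / 2 ^ k]` of rank `k` (for `i < 2 ^ k`). -/
def dyadicInterval (k i : ℕ) : Set I :=
  {x | (i : ℝ) / 2 ^ k ≤ (x : ℝ) ∧ (x : ℝ) ≤ ((i : ℝ) + 1) / 2 ^ k}

/-- `Q` is a dyadic square of rank `k` in the unit square. -/
def IsDyadicSquare (k : ℕ) (Q : Set (I × I)) : Prop :=
  ∃ i j : ℕ, i < 2 ^ k ∧ j < 2 ^ k ∧ Q = dyadicInterval k i ×ˢ dyadicInterval k j

/-- A dyadic set: a finite union of dyadic squares (of arbitrary ranks). -/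
def IsDyadicSet (D : Set (I × I)) : Prop :=
  ∃ F : Set (Set (I × I)), F.Finite ∧ (∀ Q ∈ F, ∃ k : ℕ, IsDyadicSquare k Q) ∧ D = ⋃₀ F

/-- The weak neighborhood `{V ∈ 𝒢_X : m(V D_i ∆ T D_i) < ε for all i}` of `T` in `𝒢_X`; it is a
dyadic neighborhood when all `D_i` are dyadic sets. -/
def weakNhd (T : GSquare) {N : ℕ} (D : Fin N → Set (I × I)) (ε : ℝ) : Set GSquare :=
  {V | V ∈ GX ∧
    ∀ i, (volume : Measure (I × I)).real (V.image (D i) ∆ T.image (D i)) < ε}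

/-! The neighborhood sees a transformation only through the preimages of the `D i` under its
inverse, and this leaves two kinds of freedom. First, membership in the `D i` depends on the first
coordinate only through a finite partition of `I`. Composing `T` with a map of the base therefore
replaces it by some `T₁` over an antiperiodic base without changing the sets `T (D i)`
(`Extends.exists_antiperiodic`). Second, a change on a set of small measure is harmless.

Now both bases are antiperiodic, and Rokhlin's lemma gives towers of height `n` in which every
level, and also the remainder, has measure exactly `1 / (n + 1)`. Matching the bases and the
remainders by an isomorphism, and extending by `T₀ ^ j * Φ * T₁ ^ (-j)` over level `j`, yields an
`S` that intertwines `T₁` and `T₀` inside the towers (`Extends.exists_conj_eq_off_small`). It lies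
in `𝒢_X` because the towers live in the base and every piece is an extension. The matching rests on
the classification of atomless measures by total mass. -/

/-! ### Isomorphisms modulo null sets. -/

/-- An isomorphism modulo null sets between two measure spaces. -/
structure AEIso {α β : Type*} [MeasurableSpace α] [MeasurableSpace β]
    (μ : Measure α) (ν : Measure β) where
  toFun : α → β
  invFun : β → α
  measurePreserving_toFun : MeasurePreserving toFun μ ν
  measurePreserving_invFun : MeasurePreserving invFun ν μ
  left_inv : ∀ᵐ x ∂μ, invFun (toFun x) = x
  right_inv : ∀ᵐ y ∂ν, toFun (invFun y) = y

namespace AEIso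

variable {α β γ : Type*} [MeasurableSpace α] [MeasurableSpace β] [MeasurableSpace γ]
  {μ : Measure α} {ν : Measure β} {ρ : Measure γ}

/-- The inverse isomorphism. -/
def symm (f : AEIso μ ν) : AEIso ν μ :=
  ⟨f.invFun, f.toFun, f.measurePreserving_invFun, f.measurePreserving_toFun,
    f.right_inv, f.left_inv⟩

/-- The composition of two isomorphisms. -/
def trans (f : AEIso μ ν) (g : AEIso ν ρ) : AEIso μ ρ where
  toFun := g.toFun ∘ f.toFun
  invFun := f.invFun ∘ g.invFun
  measurePreserving_toFun := g.measurePreserving_toFun.comp f.measurePreserving_toFun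
  measurePreserving_invFun := f.measurePreserving_invFun.comp g.measurePreserving_invFun
  left_inv := by
    filter_upwards [f.left_inv,
      f.measurePreserving_toFun.quasiMeasurePreserving.ae g.left_inv] with x h1 h2
    simp only [Function.comp_apply, h2, h1]
  right_inv := by
    filter_upwards [g.right_inv,
      g.measurePreserving_invFun.quasiMeasurePreserving.ae f.right_inv] with x h1 h2
    simp only [Function.comp_apply, h2, h1]

/-- An isomorphism of a measure space with itself is an invertible transformation. -/
def toInvTransf (f : AEIso μ μ) : InvTransf μ :=
  ⟨f.toFun, f.invFun, f.measurePreserving_toFun, f.measurePreserving_invFun,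
    f.left_inv, f.right_inv⟩

/-- A measure preserving map between standard Borel spaces which is injective on a conull set is
an isomorphism modulo null sets. -/
theorem exists_of_injOn [StandardBorelSpace α] [StandardBorelSpace β] [Nonempty α]
    {f : α → β} (hf : MeasurePreserving f μ ν) {s : Set α} (hs : MeasurableSet s)
    (hsμ : μ sᶜ = 0) (hinj : Set.InjOn f s) : Nonempty (AEIso μ ν) := by
  have : StandardBorelSpace s := hs.standardBorel
  -- By Lusin–Souslin, an injective measurable map of standard Borel spaces has a measurable inverse
  -- on its image.
  have hemb : MeasurableEmbedding (s.domRestrict f) :=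
    (hf.measurable.comp measurable_subtype_coe).measurableEmbedding
      (Set.injOn_iff_injective.1 hinj)
  obtain ⟨g, hg, hgf⟩ := hemb.exists_measurable_extend measurable_subtype_coe
    (fun _ => ‹Nonempty α›)
  have hleft : ∀ᵐ x ∂μ, g (f x) = x := by
    have : ∀ᵐ x ∂μ, x ∈ s := hsμ
    filter_upwards [this] with x hx
    exact congrFun hgf ⟨x, hx⟩
  have hgmp : MeasurePreserving g ν μ := by
    refine ⟨hg, ?_⟩
    rw [← hf.map_eq, Measure.map_map hg hf.measurable]
    have : g ∘ f =ᵐ[μ] id := hleft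
    rw [Measure.map_congr this, Measure.map_id]
  refine ⟨⟨f, g, hf, hgmp, hleft, ?_⟩⟩
  have hset : MeasurableSet {y | f (g y) = y} :=
    measurableSet_eq_fun (hf.measurable.comp hg) measurable_id
  rw [← hf.map_eq, ae_map_iff hf.measurable.aemeasurable hset]
  filter_upwards [hleft] with x hx
  simp [hx]

end AEIso

/-! ### Distribution functions of atomless measures on the line. -/

section Cdf

variable (ν : Measure ℝ) [IsFiniteMeasure ν] [NullSingletonClass ν]

theorem continuous_measureReal_Iic : Continuous fun x => ν.real (Set.Iic x) := by
  have h := intervalIntegral.continuous_primitive (μ := ν) (f := fun _ => (1 : ℝ))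
    (fun a b => intervalIntegrable_const) 0
  have h2 : (fun x => ν.real (Set.Iic x)) =
      fun x => (∫ _ in (0 : ℝ)..x, (1 : ℝ) ∂ν) + ν.real (Set.Iic 0) := by
    funext x
    have := intervalIntegral.integral_Iic_sub_Iic (μ := ν) (f := fun _ => (1 : ℝ)) (a := 0) (b := x)
      (integrable_const _).integrableOn (integrable_const _).integrableOn
    simp at this
    simp [← this]
  rw [h2]
  exact h.add continuous_const

/-- Each such point ends a null interval `Ioc q x` with `q` rational. For fixed `q` these points are
covered by countably many null intervals, except possibly for a largest one, which is not an atom.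
Off this set the distribution function is injective. -/
theorem measure_setOf_cdf_eq_of_lt :
    ν {x | ∃ y < x, ν.real (Set.Iic y) = ν.real (Set.Iic x)} = 0 := by
  have hmono : Monotone fun x => ν.real (Set.Iic x) := fun a b h =>
    measureReal_mono (Set.Iic_subset_Iic.2 h)
  set U : ℚ → Set ℝ := fun q => {x | (q : ℝ) < x ∧ ν (Set.Ioc (q : ℝ) x) = 0}
  have hU : ∀ q, ν (U q) = 0 := by
    intro q
    have hsub : U q ⊆ (⋃ r : {r : ℚ // (r : ℝ) ∈ U q}, Set.Ioc (q : ℝ) (r.1 : ℝ)) ∪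
        {x | x ∈ U q ∧ ∀ x' ∈ U q, x' ≤ x} := by
      intro x hx
      by_cases h : ∀ x' ∈ U q, x' ≤ x
      · exact Or.inr ⟨hx, h⟩
      · push Not at h
        obtain ⟨x', hx', hlt⟩ := h
        obtain ⟨r, hr1, hr2⟩ := exists_rat_btwn hlt
        refine Or.inl (Set.mem_iUnion.2 ⟨⟨r, hx.1.trans hr1, ?_⟩, hx.1, hr1.le⟩)
        exact measure_mono_null (Set.Ioc_subset_Ioc_right hr2.le) hx'.2
    refine measure_mono_null hsub (measure_union_null ?_ ?_)
    · exact measure_iUnion_null fun r => r.2.2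
    · refine Set.Subsingleton.measure_zero ?_ _
      intro x hx y hy
      exact le_antisymm (hy.2 x hx.1) (hx.2 y hy.1)
  refine measure_mono_null ?_ (measure_iUnion_null hU)
  rintro x ⟨y, hyx, hxy⟩
  obtain ⟨q, hq1, hq2⟩ := exists_rat_btwn hyx
  refine Set.mem_iUnion.2 ⟨q, hq2, ?_⟩
  have h1 : ν.real (Set.Iic (q : ℝ)) = ν.real (Set.Iic x) :=
    le_antisymm (hmono hq2.le) (hxy ▸ hmono hq1.le)
  have h2 : Set.Ioc (q : ℝ) x = Set.Iic x \ Set.Iic (q : ℝ) := by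
    ext z; simp [and_comm]
  rw [h2, measure_sdiff (Set.Iic_subset_Iic.2 hq2.le) measurableSet_Iic.nullMeasurableSet
    (measure_ne_top _ _), (measureReal_eq_measureReal_iff).1 h1, tsub_self]

/-- The distribution function of an atomless measure pushes it forward to Lebesgue measure. -/
theorem measurePreserving_cdf :
    MeasurePreserving (fun x => ν.real (Set.Iic x)) ν
      (volume.restrict (Set.Ioc 0 (ν.real Set.univ))) := by
  have hcont := continuous_measureReal_Iic ν
  have hmono : Monotone fun x => ν.real (Set.Iic x) := fun a b h =>
    measureReal_mono (Set.Iic_subset_Iic.2 h)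
  have hle : ∀ x, ν.real (Set.Iic x) ≤ ν.real Set.univ := fun x =>
    measureReal_mono (Set.subset_univ _)
  have hbot : Filter.Tendsto (fun x => ν.real (Set.Iic x)) Filter.atBot (nhds 0) := by
    have h := (ENNReal.tendsto_toReal (measure_ne_top _ _)).comp (tendsto_measure_Ici_atBot ν)
    have h2 : (fun x => ν.real (Set.Iic x)) =
        fun x => ν.real Set.univ - (ENNReal.toReal ∘ fun x => ν (Set.Ici x)) x := by
      funext x
      have h3 := measureReal_compl (μ := ν) (measurableSet_Ioi (a := x))
      rw [Set.compl_Ioi, measureReal_congr (Ioi_ae_eq_Ici (a := x) (μ := ν))] at h3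
      exact h3
    rw [h2]
    have h4 := h.const_sub (ν.real Set.univ)
    rwa [measureReal_def, sub_self] at h4
  have htop : Filter.Tendsto (fun x => ν.real (Set.Iic x)) Filter.atTop
      (nhds (ν.real Set.univ)) := by
    have := tendsto_measure_Iic_atTop ν
    exact (ENNReal.tendsto_toReal (measure_ne_top _ _)).comp this
  refine ⟨hcont.measurable, ?_⟩
  have : IsFiniteMeasure (ν.map fun x => ν.real (Set.Iic x)) := inferInstance
  have hmid : ∀ t, 0 < t → t < ν.real Set.univ →
      ν {x | ν.real (Set.Iic x) ≤ t} = ENNReal.ofReal t := by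
    intro t h0 h1
    obtain ⟨s, hs⟩ : ∃ s, ν.real (Set.Iic s) = t := by
      refine mem_range_of_exists_le_of_exists_ge hcont ?_ ?_
      · obtain ⟨a, ha⟩ := (hbot.eventually (gt_mem_nhds h0)).exists
        exact ⟨a, le_of_lt ha⟩
      · obtain ⟨a, ha⟩ := (htop.eventually (lt_mem_nhds h1)).exists
        exact ⟨a, le_of_lt ha⟩
    have hae : ({x | ν.real (Set.Iic x) ≤ t} : Set ℝ) =ᵐ[ν] Set.Iic s := by
      have h := measure_setOf_cdf_eq_of_lt ν
      have h' : ∀ᵐ x ∂ν, ¬ ∃ y < x, ν.real (Set.Iic y) = ν.real (Set.Iic x) := by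
        rw [ae_iff]; simpa using h
      filter_upwards [h'] with x hx
      refine propext ⟨fun hxt => ?_, fun hxs => ?_⟩
      · by_contra hcon
        have hlt : s < x := not_le.1 hcon
        exact hx ⟨s, hlt, le_antisymm (hmono hlt.le) (hs ▸ hxt)⟩
      · exact hs ▸ hmono hxs
    rw [measure_congr hae, ← hs, measureReal_def, ENNReal.ofReal_toReal (measure_ne_top _ _)]
  refine Measure.ext_of_Iic _ _ fun t => ?_
  rw [Measure.map_apply hcont.measurable measurableSet_Iic,
    Measure.restrict_apply measurableSet_Iic]
  change ν {x | ν.real (Set.Iic x) ≤ t} = _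
  rcases le_or_gt (ν.real Set.univ) t with h1 | h1
  · have : {x | ν.real (Set.Iic x) ≤ t} = Set.univ :=
      Set.eq_univ_of_forall fun x => (hle x).trans h1
    have h3 : Set.Iic t ∩ Set.Ioc 0 (ν.real Set.univ) = Set.Ioc 0 (ν.real Set.univ) :=
      Set.inter_eq_right.2 fun x hx => hx.2.trans h1
    rw [this, h3, Real.volume_Ioc, sub_zero, measureReal_def,
      ENNReal.ofReal_toReal (measure_ne_top _ _)]
  have h3 : Set.Iic t ∩ Set.Ioc 0 (ν.real Set.univ) = Set.Ioc 0 t := by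
    ext x
    simp only [Set.mem_inter_iff, Set.mem_Iic, Set.mem_Ioc]
    constructor
    · rintro ⟨a, b, c⟩; exact ⟨b, a⟩
    · rintro ⟨a, b⟩; exact ⟨b, a, b.trans h1.le⟩
  rw [h3, Real.volume_Ioc, sub_zero]
  rcases lt_or_ge 0 t with h0 | h0
  · exact hmid t h0 h1
  · rw [ENNReal.ofReal_of_nonpos h0]
    have hpos : 0 < ν.real Set.univ ∨ ν.real Set.univ = 0 :=
      (measureReal_nonneg.lt_or_eq).imp id Eq.symm
    rcases hpos with hpos | hzero
    -- The value `t ≤ 0` need not be strictly inside the range, so it is squeezed by small levels `d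
    -- > 0`; the cap at half the mass keeps `d` within reach of `hmid`.
    · refine le_antisymm (ENNReal.le_of_forall_pos_le_add fun ε hε _ => ?_) zero_le
      have hd : 0 < min (ε : ℝ) (ν.real Set.univ / 2) := by
        refine lt_min (by exact_mod_cast hε) (by linarith)
      have := hmid _ hd ((min_le_right _ _).trans_lt (by linarith))
      calc ν {x | ν.real (Set.Iic x) ≤ t}
          ≤ ν {x | ν.real (Set.Iic x) ≤ min (ε : ℝ) (ν.real Set.univ / 2)} :=
            measure_mono fun x hx => (le_trans hx h0).trans hd.le
        _ = ENNReal.ofReal (min (ε : ℝ) (ν.real Set.univ / 2)) := this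
        _ ≤ ENNReal.ofReal ε := ENNReal.ofReal_le_ofReal (min_le_left _ _)
        _ = 0 + ε := by simp
    · exact measure_mono_null (Set.subset_univ _)
        ((measureReal_eq_zero_iff).1 hzero)

end Cdf

/-! ### Classification of atomless measures, and gluing along labels. -/

namespace AEIso

variable {α β : Type*} [MeasurableSpace α] [MeasurableSpace β]

/-- A finite atomless measure on a standard Borel space is isomorphic to Lebesgue measure on an
interval. -/
theorem nonempty_lebesgue [StandardBorelSpace α] [Nonempty α] (μ : Measure α) [IsFiniteMeasure μ]
    [NullSingletonClass μ] :
    Nonempty (AEIso μ ((volume : Measure ℝ).restrict (Set.Ioc 0 (μ.real Set.univ)))) := by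
  have he := measurableEmbedding_embeddingReal α
  set e := embeddingReal α
  set ν := μ.map e with hν
  have hna : NullSingletonClass ν := by
    refine ⟨fun x => ?_⟩
    rw [hν, he.map_apply]
    exact (Set.subsingleton_singleton.preimage he.injective).measure_zero _
  have hmass : ν.real Set.univ = μ.real Set.univ := by
    rw [hν, measureReal_def, he.map_apply]; rfl
  have hmp : MeasurePreserving e μ ν := ⟨he.measurable, rfl⟩
  have hF := (measurePreserving_cdf ν).comp hmp
  rw [hmass] at hF
  have hN : μ (e ⁻¹' {x | ∃ y < x, ν.real (Set.Iic y) = ν.real (Set.Iic x)}) = 0 :=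
    hmp.quasiMeasurePreserving.preimage_null (measure_setOf_cdf_eq_of_lt ν)
  set N := e ⁻¹' {x | ∃ y < x, ν.real (Set.Iic y) = ν.real (Set.Iic x)} with hNdef
  -- The exceptional set is replaced by a measurable hull, its own measurability not being
  -- established.
  refine exists_of_injOn hF (s := (toMeasurable μ N)ᶜ) (measurableSet_toMeasurable _ _).compl
    (by rw [compl_compl, measure_toMeasurable, hN]) ?_
  have key : ∀ x ∈ (toMeasurable μ N)ᶜ, ∀ y, ν.real (Set.Iic (e x)) = ν.real (Set.Iic (e y)) →
      ¬ e y < e x := by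
    intro x hx y hxy hlt
    exact hx (subset_toMeasurable μ N ⟨e y, hlt, hxy.symm⟩)
  intro x hx y hy hxy
  exact he.injective (le_antisymm (not_lt.1 (key x hx y hxy)) (not_lt.1 (key y hy x hxy.symm)))

/-- Atomless measures of the same finite mass on standard Borel spaces are isomorphic. -/
theorem nonempty_of_measure_univ_eq [StandardBorelSpace α] [Nonempty α] [StandardBorelSpace β]
    [Nonempty β] (μ : Measure α) [IsFiniteMeasure μ] [NullSingletonClass μ] (ν : Measure β)
    [IsFiniteMeasure ν] [NullSingletonClass ν] (h : μ Set.univ = ν Set.univ) :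
    Nonempty (AEIso μ ν) := by
  obtain ⟨f⟩ := nonempty_lebesgue μ
  obtain ⟨g⟩ := nonempty_lebesgue ν
  have hr : ν.real Set.univ = μ.real Set.univ := by simp [measureReal_def, h]
  rw [hr] at g
  exact ⟨f.trans g.symm⟩

variable {ι : Type*} [Countable ι] [MeasurableSpace ι] [MeasurableSingletonClass ι]

theorem measure_eq_tsum_inter_fiber (ρ : Measure α) {r : α → ι} (hr : Measurable r) {A : Set α}
    (hA : MeasurableSet A) : ρ A = ∑' i, ρ (A ∩ r ⁻¹' {i}) := by
  rw [← measure_iUnion]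
  · congr 1; ext x; simp
  · intro i j hij
    refine Set.disjoint_left.2 fun x hx hx' => hij ?_
    exact (hx.2 : r x = i).symm.trans hx'.2
  · exact fun i => hA.inter (hr (measurableSet_singleton i))

theorem measurePreserving_glue {μ : Measure α} {ν : Measure β} {p : α → ι} {q : β → ι}
    (hp : Measurable p) (hq : Measurable q) {S : ι → α → β}
    (hS : ∀ i, MeasurePreserving (S i) (μ.restrict (p ⁻¹' {i})) (ν.restrict (q ⁻¹' {i}))) :
    MeasurePreserving (fun x => S (p x) x) μ ν := by
  have hm : Measurable fun x => S (p x) x :=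
    (measurable_from_prod_countable_right (f := fun z : ι × α => S z.1 z.2)
      fun i => (hS i).measurable).comp (hp.prodMk measurable_id)
  refine ⟨hm, Measure.ext fun E hE => ?_⟩
  rw [Measure.map_apply hm hE]
  rw [measure_eq_tsum_inter_fiber μ hp (hm hE),
    measure_eq_tsum_inter_fiber ν hq hE]
  refine tsum_congr fun i => ?_
  rw [← Measure.restrict_apply hE, ← (hS i).measure_preimage hE.nullMeasurableSet,
    Measure.restrict_apply ((hS i).measurable hE)]
  congr 1
  ext x
  simp only [Set.mem_inter_iff, Set.mem_preimage, Set.mem_singleton_iff]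
  constructor <;> · rintro ⟨h, rfl⟩; exact ⟨h, rfl⟩

/-- Isomorphisms between the fibres of two labellings glue to a global isomorphism. -/
theorem exists_glue {μ : Measure α} {ν : Measure β} {p : α → ι} {q : β → ι}
    (hp : Measurable p) (hq : Measurable q)
    (S : ∀ i, AEIso (μ.restrict (p ⁻¹' {i})) (ν.restrict (q ⁻¹' {i}))) :
    ∃ f : AEIso μ ν, (∀ x, f.toFun x = (S (p x)).toFun x) ∧ ∀ᵐ x ∂μ, q (f.toFun x) = p x := by
  have hpm : ∀ i, MeasurableSet (p ⁻¹' {i}) := fun i => hp (measurableSet_singleton i)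
  have hqm : ∀ i, MeasurableSet (q ⁻¹' {i}) := fun i => hq (measurableSet_singleton i)
  have h1 : ∀ᵐ x ∂μ, ∀ i, p x = i → q ((S i).toFun x) = i := by
    refine ae_all_iff.2 fun i => (ae_restrict_iff' (hpm i)).1 ?_
    exact (S i).measurePreserving_toFun.quasiMeasurePreserving.ae (ae_restrict_mem (hqm i))
  have h2 : ∀ᵐ y ∂ν, ∀ i, q y = i → p ((S i).invFun y) = i := by
    refine ae_all_iff.2 fun i => (ae_restrict_iff' (hqm i)).1 ?_
    exact (S i).measurePreserving_invFun.quasiMeasurePreserving.ae (ae_restrict_mem (hpm i))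
  have h3 : ∀ᵐ x ∂μ, ∀ i, p x = i → (S i).invFun ((S i).toFun x) = x :=
    ae_all_iff.2 fun i => (ae_restrict_iff' (hpm i)).1 (S i).left_inv
  have h4 : ∀ᵐ y ∂ν, ∀ i, q y = i → (S i).toFun ((S i).invFun y) = y :=
    ae_all_iff.2 fun i => (ae_restrict_iff' (hqm i)).1 (S i).right_inv
  refine ⟨⟨fun x => (S (p x)).toFun x, fun y => (S (q y)).invFun y,
    measurePreserving_glue hp hq fun i => (S i).measurePreserving_toFun,
    measurePreserving_glue hq hp fun i => (S i).measurePreserving_invFun, ?_, ?_⟩,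
    fun _ => rfl, ?_⟩
  · filter_upwards [h1, h3] with x hx hx'
    rw [hx _ rfl, hx' _ rfl]
  · filter_upwards [h2, h4] with y hy hy'
    rw [hy _ rfl, hy' _ rfl]
  · filter_upwards [h1] with x hx
    exact hx _ rfl

/-- Two atomless measures with labellings of the same distribution are isomorphic by an
isomorphism which respects the labels. -/
theorem exists_of_measure_fiber_eq [StandardBorelSpace α] [Nonempty α] [StandardBorelSpace β]
    [Nonempty β] (μ : Measure α) [IsFiniteMeasure μ] [NullSingletonClass μ] (ν : Measure β)
    [IsFiniteMeasure ν] [NullSingletonClass ν] {p : α → ι} {q : β → ι}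
    (hp : Measurable p) (hq : Measurable q) (h : ∀ i, μ (p ⁻¹' {i}) = ν (q ⁻¹' {i})) :
    ∃ f : AEIso μ ν, ∀ᵐ x ∂μ, q (f.toFun x) = p x := by
  have : ∀ i, Nonempty (AEIso (μ.restrict (p ⁻¹' {i})) (ν.restrict (q ⁻¹' {i}))) := fun i =>
    nonempty_of_measure_univ_eq _ _ (by simp [h])
  obtain ⟨f, -, hf⟩ := exists_glue hp hq fun i => (this i).some
  exact ⟨f, hf⟩

end AEIso

/-! ### Everywhere-defined bijective representatives. -/

namespace InvTransf

variable {α : Type*} [MeasurableSpace α] {μ : Measure α}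

/-- An invertible transformation agrees almost everywhere with a measurable bijection. -/
theorem exists_perm [MeasurableEq α] (T : InvTransf μ) :
    ∃ τ : Equiv.Perm α, MeasurePreserving τ μ μ ∧ MeasurePreserving τ.symm μ μ ∧
      τ =ᵐ[μ] T.toFun ∧ τ.symm =ᵐ[μ] T.invFun := by
  classical
  have hT := T.measurePreserving_toFun
  have hT' := T.measurePreserving_invFun
  set G : Set α := {x | T.invFun (T.toFun x) = x ∧ T.toFun (T.invFun x) = x}
  have hG : MeasurableSet G :=
    (measurableSet_eq_fun (hT'.measurable.comp hT.measurable) measurable_id).inter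
      (measurableSet_eq_fun (hT.measurable.comp hT'.measurable) measurable_id)
  have hGae : ∀ᵐ x ∂μ, x ∈ G := by
    filter_upwards [T.left_inv, T.right_inv] with x h1 h2 using ⟨h1, h2⟩
  -- `Y` is conull and invariant under both maps, which are mutually inverse on it; the identity off
  -- `Y` completes a bijection.
  set Y : Set α := {x | ∀ k : ℕ, T.toFun^[k] x ∈ G ∧ T.invFun^[k] x ∈ G} with hYdef
  have hY : MeasurableSet Y := by
    rw [hYdef, Set.ofPred_forall]
    exact MeasurableSet.iInter fun k =>
      ((hT.measurable.iterate k) hG).inter ((hT'.measurable.iterate k) hG)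
  have hYae : ∀ᵐ x ∂μ, x ∈ Y := by
    refine ae_all_iff.2 fun k => ?_
    filter_upwards [(hT.iterate k).quasiMeasurePreserving.ae hGae,
      (hT'.iterate k).quasiMeasurePreserving.ae hGae] with x h1 h2 using ⟨h1, h2⟩
  have hYG : ∀ x ∈ Y, x ∈ G := fun x hx => (hx 0).1
  have hTY : ∀ x ∈ Y, T.toFun x ∈ Y := by
    intro x hx k
    refine ⟨(hx (k + 1)).1, ?_⟩
    cases k with
    | zero => exact (hx 1).1
    | succ k =>
      rw [Function.iterate_succ_apply, (hYG x hx).1]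
      exact (hx k).2
  have hTY' : ∀ x ∈ Y, T.invFun x ∈ Y := by
    intro x hx k
    refine ⟨?_, (hx (k + 1)).2⟩
    cases k with
    | zero => exact (hx 1).2
    | succ k =>
      rw [Function.iterate_succ_apply, (hYG x hx).2]
      exact (hx k).1
  let τ : Equiv.Perm α :=
    { toFun := fun x => if x ∈ Y then T.toFun x else x
      invFun := fun x => if x ∈ Y then T.invFun x else x
      left_inv := fun x => by
        by_cases hx : x ∈ Y
        · simp only [hx, if_true, hTY x hx]; exact (hYG x hx).1
        · simp only [hx, if_false]
      right_inv := fun x => by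
        by_cases hx : x ∈ Y
        · simp only [hx, if_true, hTY' x hx]; exact (hYG x hx).2
        · simp only [hx, if_false] }
  have hτ : τ =ᵐ[μ] T.toFun := by
    filter_upwards [hYae] with x hx using if_pos hx
  have hτ' : τ.symm =ᵐ[μ] T.invFun := by
    filter_upwards [hYae] with x hx using if_pos hx
  refine ⟨τ, ⟨Measurable.ite hY hT.measurable measurable_id, ?_⟩,
    ⟨Measurable.ite hY hT'.measurable measurable_id, ?_⟩, hτ, hτ'⟩
  · rw [Measure.map_congr hτ, hT.map_eq]
  · rw [Measure.map_congr hτ', hT'.map_eq]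

theorem iterate_ae_eq {f g : α → α} (hg : MeasurePreserving g μ μ) (h : f =ᵐ[μ] g) (n : ℕ) :
    f^[n] =ᵐ[μ] g^[n] := by
  induction n with
  | zero => exact Filter.EventuallyEq.rfl
  | succ n ih =>
    filter_upwards [h, hg.quasiMeasurePreserving.ae ih] with x h1 h2
    rw [Function.iterate_succ_apply, Function.iterate_succ_apply, h1, h2]

theorem measurePreserving_zpow {τ : Equiv.Perm α} (h : MeasurePreserving τ μ μ)
    (h' : MeasurePreserving τ.symm μ μ) (i : ℤ) :
    MeasurePreserving (fun x => (τ ^ i) x) μ μ := by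
  cases i with
  | ofNat n =>
    have : (fun x => (τ ^ (Int.ofNat n)) x) = τ^[n] := by
      rw [Equiv.Perm.iterate_eq_pow]; rfl
    rw [this]; exact h.iterate n
  | negSucc n =>
    have : (fun x => (τ ^ (Int.negSucc n)) x) = (τ.symm)^[n + 1] := by
      rw [zpow_negSucc, ← inv_pow]
      exact (Equiv.Perm.iterate_eq_pow τ⁻¹ (n + 1)).symm
    rw [this]; exact h'.iterate (n + 1)

end InvTransf

/-! ### Marker sets and Rokhlin's lemma. -/

section Rokhlin

open Set

variable {α : Type*} [MeasurableSpace α]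

/-- A measurable marker set which is disjoint from its first `N` translates and whose translates
cover the space almost surely. -/
theorem exists_marker [TopologicalSpace α] [SecondCountableTopology α] [T1Space α]
    [OpensMeasurableSpace α] {μ : Measure α} {τ : Equiv.Perm α}
    (hτ : ∀ i : ℤ, MeasurePreserving (fun x => (τ ^ i) x) μ μ)
    (hanti : ∀ n : ℕ, 0 < n → ∀ᵐ x ∂μ, (τ ^ (n : ℤ)) x ≠ x) (N : ℕ) :
    ∃ A : Set α, MeasurableSet A ∧ (∀ x ∈ A, ∀ i : ℕ, 0 < i → i ≤ N → (τ ^ (i : ℤ)) x ∉ A) ∧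
      ∀ᵐ x ∂μ, ∃ s : ℕ, (τ ^ (s : ℤ)) x ∈ A := by
  obtain ⟨g, hg⟩ : ∃ g : ℕ → Set α, (∀ m, IsOpen (g m)) ∧
      ∀ x, ∀ U, IsOpen U → x ∈ U → ∃ m, x ∈ g m ∧ g m ⊆ U := by
    obtain ⟨b, hbc, hb0, hb⟩ := TopologicalSpace.exists_countable_basis α
    rcases b.eq_empty_or_nonempty with rfl | hne
    · refine ⟨fun _ => ∅, fun _ => isOpen_empty, fun x U hU hx => ?_⟩
      obtain ⟨v, hv, -⟩ := hb.exists_subset_of_mem_open hx hU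
      exact absurd hv (notMem_empty _)
    · obtain ⟨g, hg⟩ := hbc.exists_eq_range hne
      refine ⟨g, fun m => hb.isOpen (hg ▸ mem_range_self m), fun x U hU hx => ?_⟩
      obtain ⟨v, hv, hxv, hvU⟩ := hb.exists_subset_of_mem_open hx hU
      obtain ⟨m, rfl⟩ := hg ▸ hv
      exact ⟨m, hxv, hvU⟩
  obtain ⟨hgo, hgb⟩ := hg
  -- Points of a basic open set that do not return to it within `N` steps. Almost every point lies
  -- in one, since some basic neighborhood avoids its finitely many translates.
  set E : ℕ → Set α := fun m =>
    {x | x ∈ g m ∧ ∀ i : ℕ, 0 < i → i ≤ N → (τ ^ (i : ℤ)) x ∉ g m} with hEdef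
  have hEm : ∀ m, MeasurableSet (E m) := by
    intro m
    refine (hgo m).measurableSet.inter ?_
    change MeasurableSet {x | ∀ i : ℕ, 0 < i → i ≤ N → (τ ^ (i : ℤ)) x ∉ g m}
    simp only [ofPred_forall]
    exact .iInter fun i => .iInter fun _ => .iInter fun _ =>
      ((hτ i).measurable (hgo m).measurableSet).compl
  have hEcov : ∀ᵐ x ∂μ, ∃ m, x ∈ E m := by
    have : ∀ᵐ x ∂μ, ∀ i : ℕ, 0 < i → (τ ^ (i : ℤ)) x ≠ x :=
      by
      refine ae_all_iff.2 fun i => ?_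
      by_cases h0 : 0 < i
      · filter_upwards [hanti i h0] with x hx _ using hx
      · exact Filter.Eventually.of_forall fun x h => absurd h h0
    filter_upwards [this] with x hx
    have hfin : ((fun i : ℕ => (τ ^ (i : ℤ)) x) '' (Finset.Icc 1 N : Set ℕ)).Finite :=
      (Finset.finite_toSet _).image _
    obtain ⟨m, hxm, hsub⟩ := hgb x _ hfin.isClosed.isOpen_compl (by
      rintro ⟨i, hi, hix⟩
      have := Finset.mem_Icc.1 (Finset.mem_coe.1 hi)
      exact hx i this.1 hix)
    refine ⟨m, hxm, fun i h0 hi hmem => hsub hmem ⟨i, ?_, rfl⟩⟩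
    exact Finset.mem_coe.2 (Finset.mem_Icc.2 ⟨h0, hi⟩)
  -- Greedy construction: add from `E m` every point at orbit distance more than `N` from the
  -- markers already chosen.
  set step : ℕ → Set α → Set α := fun m A =>
    A ∪ {x | x ∈ E m ∧ ∀ i : ℕ, 0 < i → i ≤ N → (τ ^ (i : ℤ)) x ∉ A ∧ (τ ^ (-i : ℤ)) x ∉ A}
    with hstep
  set A : ℕ → Set α := fun m => Nat.rec ∅ step m with hA
  have hA1 : ∀ m, A (m + 1) = step m (A m) := fun m => rfl
  have hAm : ∀ m, MeasurableSet (A m) := by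
    intro m
    induction m with
    | zero => exact MeasurableSet.empty
    | succ m ih =>
      rw [hA1]
      refine ih.union ((hEm m).inter ?_)
      change MeasurableSet {x | ∀ i : ℕ, 0 < i → i ≤ N →
        (τ ^ (i : ℤ)) x ∉ A m ∧ (τ ^ (-i : ℤ)) x ∉ A m}
      simp only [ofPred_forall]
      exact .iInter fun i => .iInter fun _ => .iInter fun _ =>
        ((hτ i).measurable ih).compl.inter ((hτ (-i)).measurable ih).compl
  have hmono : Monotone A := monotone_nat_of_le_succ fun m => by
    rw [hA1]; exact subset_union_left
  have hsep : ∀ m, ∀ x ∈ A m, ∀ i : ℕ, 0 < i → i ≤ N → (τ ^ (i : ℤ)) x ∉ A m := by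
    intro m
    induction m with
    | zero => intro x hx; exact absurd hx (notMem_empty _)
    | succ m ih =>
      rw [hA1]
      rintro x hx i h0 hi hix
      rcases hx with hx | hx <;> rcases hix with hix | hix
      · exact ih x hx i h0 hi hix
      · refine (hix.2 i h0 hi).2 ?_
        rwa [← Equiv.Perm.mul_apply, ← zpow_add, neg_add_cancel, zpow_zero]
      · exact (hx.2 i h0 hi).1 hix
      · exact hx.1.2 i h0 hi hix.1.1
  refine ⟨⋃ m, A m, .iUnion hAm, ?_, ?_⟩
  · intro x hx i h0 hi hix
    obtain ⟨m, hm⟩ := mem_iUnion.1 hx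
    obtain ⟨m', hm'⟩ := mem_iUnion.1 hix
    exact hsep (max m m') x (hmono (le_max_left _ _) hm) i h0 hi (hmono (le_max_right _ _) hm')
  -- A marker lies within distance `N` of `τ ^ N x`, on either side; starting from `τ ^ N x` makes
  -- the hitting time from `x` nonnegative.
  · filter_upwards [(hτ N).quasiMeasurePreserving.ae hEcov] with x hx
    obtain ⟨m, hm⟩ := hx
    by_cases h : ∃ i : ℕ, 0 < i ∧ i ≤ N ∧
        ((τ ^ (i : ℤ)) ((τ ^ (N : ℤ)) x) ∈ A m ∨ (τ ^ (-i : ℤ)) ((τ ^ (N : ℤ)) x) ∈ A m)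
    · obtain ⟨i, h0, hi, h | h⟩ := h
      · refine ⟨i + N, mem_iUnion.2 ⟨m, ?_⟩⟩
        rwa [Nat.cast_add, zpow_add, Equiv.Perm.mul_apply]
      · refine ⟨N - i, mem_iUnion.2 ⟨m, ?_⟩⟩
        rwa [← Equiv.Perm.mul_apply, ← zpow_add, neg_add_eq_sub, ← Nat.cast_sub hi] at h
    · push Not at h
      exact ⟨N, mem_iUnion.2 ⟨m + 1, Or.inr ⟨hm, h⟩⟩⟩

/-- Every measurable set of a finite atomless measure contains subsets of any smaller measure. -/
theorem exists_measurable_subset_measure_eq [StandardBorelSpace α] {μ : Measure α}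
    [IsFiniteMeasure μ] [NullSingletonClass μ] {B : Set α} (hB : MeasurableSet B) {c : ENNReal}
    (hc : c ≤ μ B) : ∃ B' ⊆ B, MeasurableSet B' ∧ μ B' = c := by
  cases isEmpty_or_nonempty α with
  | inl h =>
    refine ⟨B, subset_rfl, hB, le_antisymm ?_ hc⟩
    rw [Subsingleton.elim B ∅, measure_empty]; exact zero_le
  | inr h =>
  obtain ⟨f⟩ := AEIso.nonempty_lebesgue (μ.restrict B)
  have hmass : (μ.restrict B).real univ = μ.real B := by simp [measureReal_def]
  have hctop : c ≠ ⊤ := ne_top_of_le_ne_top (measure_ne_top _ _) hc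
  refine ⟨f.toFun ⁻¹' Iic c.toReal ∩ B, inter_subset_right,
    (f.measurePreserving_toFun.measurable measurableSet_Iic).inter hB, ?_⟩
  rw [← Measure.restrict_apply (f.measurePreserving_toFun.measurable measurableSet_Iic),
    f.measurePreserving_toFun.measure_preimage measurableSet_Iic.nullMeasurableSet,
    Measure.restrict_apply measurableSet_Iic, hmass]
  have hle : c.toReal ≤ μ.real B := ENNReal.toReal_mono (measure_ne_top _ _) hc
  have : Iic c.toReal ∩ Ioc 0 (μ.real B) = Ioc 0 c.toReal := by
    ext x
    simp only [mem_inter_iff, mem_Iic, mem_Ioc]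
    constructor
    · rintro ⟨a, b, -⟩; exact ⟨b, a⟩
    · rintro ⟨a, b⟩; exact ⟨b, a, b.trans hle⟩
  rw [this, Real.volume_Ioc, sub_zero, ENNReal.ofReal_toReal hctop]

/-- The `N + 1` preimages of `A` are disjoint, have equal measure, and fit in a probability space.
-/
theorem measure_le_of_disjoint_translates {μ : Measure α} [IsProbabilityMeasure μ]
    {τ : Equiv.Perm α} (hτ : ∀ i : ℤ, MeasurePreserving (fun x => (τ ^ i) x) μ μ) {A : Set α}
    (hA : MeasurableSet A) {N : ℕ}
    (hdisj : ∀ x ∈ A, ∀ i : ℕ, 0 < i → i ≤ N → (τ ^ (i : ℤ)) x ∉ A) :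
    ((N : ENNReal) + 1) * μ A ≤ 1 := by
  have hd : ∀ i j : ℕ, i < j → j ≤ N →
      Disjoint ((fun x => (τ ^ (i : ℤ)) x) ⁻¹' A) ((fun x => (τ ^ (j : ℤ)) x) ⁻¹' A) := by
    intro i j hij hj
    refine disjoint_left.2 fun x hx hx' => ?_
    refine hdisj _ hx (j - i) (by omega) (by omega) ?_
    rw [← Equiv.Perm.mul_apply, ← zpow_add]
    have : ((j - i : ℕ) : ℤ) + i = j := by omega
    rw [this]
    exact hx'
  have h := measure_biUnion_finset (μ := μ) (s := Finset.range (N + 1))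
    (f := fun i : ℕ => (fun x => (τ ^ (i : ℤ)) x) ⁻¹' A) (by
      intro i hi j hj hij
      have hi' := Finset.mem_range.1 (Finset.mem_coe.1 hi)
      have hj' := Finset.mem_range.1 (Finset.mem_coe.1 hj)
      rcases lt_or_gt_of_ne hij with h | h
      · exact hd i j h (by omega)
      · exact (hd j i h (by omega)).symm) (fun i _ => (hτ i).measurable hA)
  simp only [(hτ _).measure_preimage hA.nullMeasurableSet, Finset.sum_const, Finset.card_range,
    nsmul_eq_mul, Nat.cast_add, Nat.cast_one] at h
  rw [← h]
  exact prob_le_one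

end Rokhlin

section Rokhlin

open Set

variable {α : Type*} [MeasurableSpace α] [TopologicalSpace α] [PolishSpace α] [BorelSpace α]
  {μ : Measure α} [IsProbabilityMeasure μ] [NullSingletonClass μ]

/-- **Rokhlin's lemma**: an antiperiodic transformation has a tower of height `n` whose base has
measure exactly `1 / (n + 1)`. -/
theorem exists_rokhlin_base {τ : Equiv.Perm α}
    (hτ : ∀ i : ℤ, MeasurePreserving (fun x => (τ ^ i) x) μ μ)
    (hanti : ∀ n : ℕ, 0 < n → ∀ᵐ x ∂μ, (τ ^ (n : ℤ)) x ≠ x) {n : ℕ} (hn : 0 < n) :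
    ∃ B : Set α, MeasurableSet B ∧ (∀ x ∈ B, ∀ i : ℕ, 0 < i → i < n → (τ ^ (i : ℤ)) x ∉ B) ∧
      μ.real B = 1 / (n + 1) := by
  -- With this gap `μ A < 1 / (n * (n + 1)) = 1 / n - 1 / (n + 1)`, exactly the loss that the base
  -- can afford.
  obtain ⟨A, hA, hAdisj, hAcov⟩ := exists_marker hτ hanti (n * (n + 1))
  have hAle := measure_le_of_disjoint_translates hτ hA hAdisj
  have hAle' : ((n : ℝ) * (n + 1) + 1) * μ.real A ≤ 1 := by
    have := ENNReal.toReal_mono ENNReal.one_ne_top hAle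
    rw [ENNReal.toReal_mul, ENNReal.toReal_add (ENNReal.natCast_ne_top _) ENNReal.one_ne_top,
      ENNReal.toReal_natCast, ENNReal.toReal_one] at this
    exact_mod_cast this
  -- Points whose first hitting time of `A` is a positive multiple of `n`. Before the hit this time
  -- drops by one per step, so `B` is not revisited within `n - 1` steps.
  set B : Set α := {x | ∃ m : ℕ, 0 < m ∧ (τ ^ ((n * m : ℕ) : ℤ)) x ∈ A ∧
    ∀ i : ℕ, i < n * m → (τ ^ (i : ℤ)) x ∉ A} with hBdef
  have hB : MeasurableSet B := by
    have : B = ⋃ m : ℕ, ⋃ _ : 0 < m, ((fun x => (τ ^ ((n * m : ℕ) : ℤ)) x) ⁻¹' A) ∩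
        ⋂ i : ℕ, ⋂ _ : i < n * m, ((fun x => (τ ^ (i : ℤ)) x) ⁻¹' A)ᶜ := by
      ext x
      simp only [hBdef, mem_ofPred_eq, mem_iUnion, mem_inter_iff, mem_iInter, mem_preimage,
        mem_compl_iff, exists_prop]
    rw [this]
    exact .iUnion fun m => .iUnion fun _ => ((hτ _).measurable hA).inter
      (.iInter fun i => .iInter fun _ => ((hτ _).measurable hA).compl)
  have hBdisj : ∀ x ∈ B, ∀ i : ℕ, 0 < i → i < n → (τ ^ (i : ℤ)) x ∉ B := by
    rintro x ⟨m, hm, hmA, hmlt⟩ i h0 hi ⟨m', hm', hmA', hmlt'⟩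
    have hle : n ≤ n * m := Nat.le_mul_of_pos_right n hm
    have e : ∀ k : ℕ, (τ ^ (k : ℤ)) ((τ ^ (i : ℤ)) x) = (τ ^ ((k + i : ℕ) : ℤ)) x := fun k => by
      rw [← Equiv.Perm.mul_apply, ← zpow_add]; norm_cast
    rw [e] at hmA'
    have h1 : n * m ≤ n * m' + i := not_lt.1 fun h => hmlt _ h hmA'
    have h2 : n * m' + i ≤ n * m := by
      by_contra h
      refine hmlt' (n * m - i) (by omega) ?_
      rw [e, Nat.sub_add_cancel (by omega)]
      exact hmA
    have h3 : n ∣ i := by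
      have : i = n * m - n * m' := by omega
      rw [this, ← Nat.mul_sub]
      exact dvd_mul_right _ _
    exact absurd (Nat.le_of_dvd h0 h3) (not_le.2 hi)
  -- Moving back `j < n` steps rounds the hitting time up to a multiple of `n`. This lands in `B`
  -- unless `A` is met within these steps, whence the union with `A`.
  have hcov : ∀ᵐ x ∂μ, x ∈ ⋃ j ∈ Finset.range n,
      (fun x => (τ ^ (-(j : ℤ))) x) ⁻¹' (B ∪ A) := by
    filter_upwards [hAcov] with x hx
    classical
    by_contra hcon
    simp only [mem_iUnion, Finset.mem_range, mem_preimage, exists_prop, not_exists, not_and,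
      mem_union, not_or] at hcon
    have hs := Nat.find_spec hx
    have hmin : ∀ i < Nat.find hx, (τ ^ (i : ℤ)) x ∉ A := fun i hi => Nat.find_min hx hi
    set s := Nat.find hx
    have hs0 : 0 < s := by
      rcases Nat.eq_zero_or_pos s with h | h
      · rw [h] at hs
        exact absurd hs (by simpa using (hcon 0 hn).2)
      · exact h
    obtain ⟨j, hj, m, hm⟩ : ∃ j < n, ∃ m, s + j = n * m := by
      rcases Nat.eq_zero_or_pos (s % n) with h | h
      · exact ⟨0, hn, s / n, by
          rw [add_zero]
          exact (Nat.mul_div_cancel' (Nat.dvd_of_mod_eq_zero h)).symm⟩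
      · refine ⟨n - s % n, by omega, s / n + 1, ?_⟩
        have := Nat.div_add_mod s n
        have := Nat.mod_lt s hn
        rw [mul_add, mul_one]
        omega
    have e : ∀ k : ℕ, (τ ^ (k : ℤ)) ((τ ^ (-(j : ℤ))) x) = (τ ^ ((k : ℤ) - j)) x := fun k => by
      rw [← Equiv.Perm.mul_apply, ← zpow_add, sub_eq_add_neg]
    refine (hcon j hj).1 ⟨m, ?_, ?_, ?_⟩
    · rcases Nat.eq_zero_or_pos m with h | h
      · rw [h] at hm; omega
      · exact h
    · rw [e, ← hm]
      have : ((s + j : ℕ) : ℤ) - j = s := by push_cast; ring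
      rwa [this]
    · intro i hi
      rw [e]
      rcases lt_or_ge i j with h | h
      · have h' := (hcon (j - i) (by omega)).2
        have : -((j - i : ℕ) : ℤ) = i - j := by omega
        rwa [this] at h'
      · have h' := hmin (i - j) (by omega)
        have : ((i - j : ℕ) : ℤ) = i - j := by omega
        rwa [this] at h'
  have hreal : (1 : ℝ) ≤ n * (μ.real B + μ.real A) := by
    have h1 : μ.real (⋃ j ∈ Finset.range n, (fun x => (τ ^ (-(j : ℤ))) x) ⁻¹' (B ∪ A)) = 1 := by
      exact (measureReal_congr (Filter.eventuallyEq_univ.2 hcov)).trans probReal_univ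
    rw [← h1]
    refine (measureReal_biUnion_finset_le _ _).trans ?_
    have h2 : ∀ j ∈ Finset.range n, μ.real ((fun x => (τ ^ (-(j : ℤ))) x) ⁻¹' (B ∪ A)) ≤
        μ.real B + μ.real A := fun j _ => by
      rw [(hτ _).measureReal_preimage (hB.union hA).nullMeasurableSet]
      exact measureReal_union_le _ _
    refine (Finset.sum_le_sum h2).trans_eq ?_
    simp [mul_add]
  have hBge : 1 / ((n : ℝ) + 1) ≤ μ.real B := by
    have hn' : (0 : ℝ) < n := by exact_mod_cast hn
    rw [div_le_iff₀ (by positivity)]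
    have ha : 0 ≤ μ.real A := measureReal_nonneg
    have h1 : (n : ℝ) * 1 ≤ n * (μ.real B * (n + 1)) := by nlinarith
    exact le_of_mul_le_mul_left h1 hn'
  -- Shrinking the base to exact measure makes the level and remainder sizes the same for every
  -- transformation, so that two towers can be matched.
  obtain ⟨B', hsub, hB', hmeas⟩ := exists_measurable_subset_measure_eq (μ := μ) hB
    (c := ENNReal.ofReal (1 / ((n : ℝ) + 1)))
    (ENNReal.ofReal_le_of_le_toReal hBge)
  refine ⟨B', hB', fun x hx i h0 hi h => hBdisj x (hsub hx) i h0 hi (hsub h), ?_⟩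
  rw [measureReal_def, hmeas, ENNReal.toReal_ofReal (by positivity)]

/-- The labelling of the levels of a Rokhlin tower of height `n`; the complement of the tower gets
the label `n`. -/
theorem InvTransf.Antiperiodic.exists_tower {T : InvTransf μ} (hT : T.Antiperiodic) {n : ℕ}
    (hn : 0 < n) :
    ∃ l : α → ℕ, Measurable l ∧ (∀ x, l x ≤ n) ∧
      (∀ j, j + 1 < n → ∀ᵐ x ∂μ, l (T x) = j + 1 ↔ l x = j) ∧
      ∀ j ≤ n, μ.real (l ⁻¹' {j}) = 1 / (n + 1) := by
  classical
  obtain ⟨τ, hτ, hτ', hτT, -⟩ := T.exists_perm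
  have hz := measurePreserving_zpow hτ hτ'
  obtain ⟨B, hB, hdisj, hμB⟩ := exists_rokhlin_base hz (fun m hm => by
    filter_upwards [hT m hm, iterate_ae_eq T.measurePreserving_toFun hτT m] with x h1 h2
    rw [zpow_natCast, ← Equiv.Perm.iterate_eq_pow, h2]
    exact h1) hn
  set l : α → ℕ := fun x =>
    if h : ∃ j, j < n ∧ (τ ^ (-(j : ℤ))) x ∈ B then Nat.find h else n with hl
  have huniq : ∀ x i j, i < j → j < n → (τ ^ (-(j : ℤ))) x ∈ B → (τ ^ (-(i : ℤ))) x ∉ B := by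
    intro x i j hij hj h h'
    refine hdisj _ h (j - i) (by omega) (by omega) ?_
    rw [← Equiv.Perm.mul_apply, ← zpow_add]
    have : ((j - i : ℕ) : ℤ) + -j = -i := by omega
    rwa [this]
  have hchar : ∀ x j, j < n → (l x = j ↔ (τ ^ (-(j : ℤ))) x ∈ B) := by
    intro x j hj
    by_cases h : ∃ j, j < n ∧ (τ ^ (-(j : ℤ))) x ∈ B
    · have hlx : l x = Nat.find h := dif_pos h
      have hs := Nat.find_spec h
      rw [← hlx] at hs
      refine ⟨fun e => e ▸ hs.2, fun hjB => ?_⟩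
      rcases lt_trichotomy (l x) j with h1 | h1 | h1
      · exact absurd hs.2 (huniq x _ _ h1 hj hjB)
      · exact h1
      · exact absurd hjB (huniq x _ _ h1 hs.1 hs.2)
    · have hlx : l x = n := dif_neg h
      refine ⟨fun e => by omega, fun hjB => absurd ⟨j, hj, hjB⟩ h⟩
  have hle : ∀ x, l x ≤ n := by
    intro x
    by_cases h : ∃ j, j < n ∧ (τ ^ (-(j : ℤ))) x ∈ B
    · have hlx : l x = Nat.find h := dif_pos h
      rw [hlx]; exact (Nat.find_spec h).1.le
    · exact (dif_neg h : l x = n).le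
  have hpre : ∀ j < n, l ⁻¹' {j} = (fun x => (τ ^ (-(j : ℤ))) x) ⁻¹' B := by
    intro j hj
    ext x
    exact hchar x j hj
  have hmlt : ∀ j < n, MeasurableSet (l ⁻¹' {j}) := fun j hj => by
    rw [hpre j hj]; exact (hz _).measurable hB
  have hpren : l ⁻¹' {n} = (⋃ j ∈ Finset.range n, l ⁻¹' {j})ᶜ := by
    ext x
    simp only [mem_preimage, mem_singleton_iff, mem_compl_iff, mem_iUnion, Finset.mem_range,
      exists_prop, exists_eq_right', not_lt]
    exact ⟨fun h => h.ge, fun h => le_antisymm (hle x) h⟩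
  have hmU : MeasurableSet (⋃ j ∈ Finset.range n, l ⁻¹' {j}) :=
    .iUnion fun j => .iUnion fun hj => hmlt j (Finset.mem_range.1 hj)
  have hμlt : ∀ j < n, μ.real (l ⁻¹' {j}) = 1 / (n + 1) := fun j hj => by
    rw [hpre j hj, (hz _).measureReal_preimage hB.nullMeasurableSet, hμB]
  refine ⟨l, measurable_to_countable' fun j => ?_, hle, ?_, ?_⟩
  · rcases lt_trichotomy j n with h | h | h
    · exact hmlt j h
    · rw [h, hpren]; exact hmU.compl
    · convert MeasurableSet.empty
      ext x
      simp only [mem_preimage, mem_singleton_iff, mem_empty_iff_false, iff_false]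
      have := hle x
      omega
  · intro j hj
    filter_upwards [hτT] with x hx
    have : -((j + 1 : ℕ) : ℤ) + 1 = -j := by push_cast; ring
    rw [← hx, hchar _ _ hj, hchar _ _ (by omega), ← this, zpow_add, zpow_one,
      Equiv.Perm.mul_apply]
  · intro j hj
    rcases hj.lt_or_eq with h | rfl
    · exact hμlt j h
    · rw [hpren, measureReal_compl hmU, measureReal_biUnion_finset]
      · rw [Finset.sum_congr rfl fun i hi => hμlt i (Finset.mem_range.1 hi)]
        simp only [probReal_univ, Finset.sum_const, Finset.card_range, nsmul_eq_mul]
        field_simp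
        ring
      · intro i _ k _ hik
        exact disjoint_left.2 fun x hx hx' => hik ((hx : l x = i).symm.trans hx')
      · exact fun i hi => hmlt i (Finset.mem_range.1 hi)

end Rokhlin

/-! ### Gluing transformations, and antiperiodic models on the base. -/

namespace InvTransf

section General

variable {α : Type*} [MeasurableSpace α] {μ : Measure α}

/-- The identity transformation. -/
instance : One (InvTransf μ) where
  one := ⟨id, id, .id μ, .id μ, .of_forall fun _ => rfl, .of_forall fun _ => rfl⟩

/-- An invertible transformation as an isomorphism modulo null sets. -/
def toAEIso (T : InvTransf μ) : AEIso μ μ :=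
  ⟨T.toFun, T.invFun, T.measurePreserving_toFun, T.measurePreserving_invFun,
    T.left_inv, T.right_inv⟩

/-- The equivalence of labels, not just one implication, makes each `S i` restrict to an isomorphism
from the fibre of `p` onto that of `q`. -/
theorem exists_glue {ι : Type*} [Countable ι] [MeasurableSpace ι] [MeasurableSingletonClass ι]
    (S : ι → InvTransf μ) {p q : α → ι} (hp : Measurable p) (hq : Measurable q)
    (h : ∀ i, ∀ᵐ x ∂μ, q (S i x) = i ↔ p x = i) :
    ∃ f : InvTransf μ, ∀ x, f x = S (p x) x := by
  have hpm : ∀ i, MeasurableSet (p ⁻¹' {i}) := fun i => hp (measurableSet_singleton i)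
  have hqm : ∀ i, MeasurableSet (q ⁻¹' {i}) := fun i => hq (measurableSet_singleton i)
  have h1 : ∀ i, MeasurePreserving (S i).toFun (μ.restrict (p ⁻¹' {i}))
      (μ.restrict (q ⁻¹' {i})) := by
    intro i
    have := (S i).measurePreserving_toFun.restrict_preimage (hqm i)
    rwa [Measure.restrict_congr_set (t := p ⁻¹' {i})] at this
    filter_upwards [h i] with x hx
    exact propext hx
  have h2 : ∀ i, MeasurePreserving (S i).invFun (μ.restrict (q ⁻¹' {i}))
      (μ.restrict (p ⁻¹' {i})) := by
    intro i
    have := (S i).measurePreserving_invFun.restrict_preimage (hpm i)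
    rwa [Measure.restrict_congr_set (t := q ⁻¹' {i})] at this
    filter_upwards [(S i).measurePreserving_invFun.quasiMeasurePreserving.ae (h i),
      (S i).right_inv] with x hx hx'
    rw [hx'] at hx
    exact propext hx.symm
  obtain ⟨f, hf, -⟩ := AEIso.exists_glue hp hq fun i =>
    ⟨(S i).toFun, (S i).invFun, h1 i, h2 i, ae_restrict_of_ae (S i).left_inv,
      ae_restrict_of_ae (S i).right_inv⟩
  exact ⟨f.toInvTransf, hf⟩

/-- The transformations `A ^ j * Φ * B ^ (-j)`. -/
def conjSeq (A Φ B : InvTransf μ) : ℕ → InvTransf μ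
  | 0 => Φ
  | j + 1 => A * conjSeq A Φ B j * B⁻¹

/-- Inductively, `B⁻¹` descends one level in the source tower and `A` climbs one in the target
tower. -/
theorem conjSeq_label {A Φ B : InvTransf μ} {p q : α → ℕ} {n : ℕ}
    (hp : ∀ j, j + 1 < n → ∀ᵐ x ∂μ, p (B x) = j + 1 ↔ p x = j)
    (hq : ∀ j, j + 1 < n → ∀ᵐ x ∂μ, q (A x) = j + 1 ↔ q x = j)
    (hΦ : ∀ᵐ x ∂μ, q (Φ x) = p x) (j : ℕ) (hj : j < n) :
    ∀ᵐ x ∂μ, q (conjSeq A Φ B j x) = j ↔ p x = j := by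
  induction j with
  | zero => filter_upwards [hΦ] with x hx using (by rw [← hx]; rfl)
  | succ j ih =>
    have hB := B.measurePreserving_invFun.quasiMeasurePreserving
    have hS := (conjSeq A Φ B j).measurePreserving_toFun.quasiMeasurePreserving
    filter_upwards [hB.ae (hS.ae (hq j hj)), hB.ae (ih (by omega)), hB.ae (hp j hj),
      B.right_inv] with x h1 h2 h3 h4
    rw [h4] at h3
    exact h1.trans (h2.trans h3.symm)

end General

/-- The product of two transformations of the interval. -/
def prodMap (T U : GInterval) : GSquare where
  toFun := Prod.map T.toFun U.toFun
  invFun := Prod.map T.invFun U.invFun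
  measurePreserving_toFun := T.measurePreserving_toFun.prod U.measurePreserving_toFun
  measurePreserving_invFun := T.measurePreserving_invFun.prod U.measurePreserving_invFun
  left_inv := by
    filter_upwards [Measure.quasiMeasurePreserving_fst.ae T.left_inv,
      Measure.quasiMeasurePreserving_snd.ae U.left_inv] with z h1 h2
    exact Prod.ext h1 h2
  right_inv := by
    filter_upwards [Measure.quasiMeasurePreserving_fst.ae T.right_inv,
      Measure.quasiMeasurePreserving_snd.ae U.right_inv] with z h1 h2
    exact Prod.ext h1 h2

/-- Given any `T'`, there is an antiperiodic `V` which moves each piece of a given finite partition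
to the same place as `T'` does. -/
theorem exists_antiperiodic_label_eq (T' : GInterval) {U : GInterval} (hU : U.Antiperiodic)
    {κ : Type*} [Countable κ] [MeasurableSpace κ] [MeasurableSingletonClass κ] {a : I → κ}
    (ha : Measurable a) :
    ∃ V : GInterval, V.Antiperiodic ∧ ∀ᵐ x : I, a (V.invFun x) = a (T'.invFun x) := by
  -- Recording the cell of `x` together with that of its preimage lets a `c`-preserving `ψ` carry
  -- `T' × U` back to the interval: the first factor controls the motion of cells, the second gives
  -- antiperiodicity.
  set c : I → κ × κ := fun x => (a x, a (T'.invFun x))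
  have hc : Measurable c := ha.prodMk (ha.comp T'.measurePreserving_invFun.measurable)
  have : NullSingletonClass (volume : Measure (I × I)) :=
    inferInstanceAs (NullSingletonClass ((volume : Measure I).prod volume))
  obtain ⟨ψ, hψ⟩ := AEIso.exists_of_measure_fiber_eq (volume : Measure I)
    (volume : Measure (I × I)) (p := c) (q := fun z => c z.1) hc (hc.comp measurable_fst)
    (fun i => by
      have h := (measurePreserving_fst (μ := (volume : Measure I))
        (ν := (volume : Measure I))).measure_preimage
        (hc (measurableSet_singleton i)).nullMeasurableSet
      exact h.symm)
  have hψm := ψ.measurePreserving_toFun.quasiMeasurePreserving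
  have hψm' := ψ.measurePreserving_invFun.quasiMeasurePreserving
  set P : GSquare := prodMap T' U with hP
  set V : GInterval := ((ψ.trans P.toAEIso).trans ψ.symm).toInvTransf with hV
  refine ⟨V, ?_, ?_⟩
  · intro n hn
    have h1 : ∀ᵐ x : I, ψ.toFun (V x) = P (ψ.toFun x) :=
      (P.measurePreserving_toFun.quasiMeasurePreserving.comp hψm).ae ψ.right_inv
    have h2 : ∀ m : ℕ, ∀ᵐ x : I, ψ.toFun (V.toFun^[m] x) = P.toFun^[m] (ψ.toFun x) := by
      intro m
      induction m with
      | zero => exact .of_forall fun _ => rfl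
      | succ m ih =>
        filter_upwards [h1, V.measurePreserving_toFun.quasiMeasurePreserving.ae ih] with x hx hx'
        rw [Function.iterate_succ_apply, Function.iterate_succ_apply, hx', hx]
    have h3 : ∀ᵐ z : I × I, U.toFun^[n] z.2 ≠ z.2 :=
      Measure.quasiMeasurePreserving_snd.ae (hU n hn)
    filter_upwards [h2 n, hψm.ae h3] with x hx hx' heq
    rw [heq] at hx
    refine hx' ?_
    have h4 : P.toFun^[n] = Prod.map T'.toFun^[n] U.toFun^[n] := Prod.map_iterate _ _ _
    rw [h4] at hx
    exact (congrArg Prod.snd hx).symm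
  · have h1 : ∀ᵐ z : I × I, c (ψ.invFun z) = c z.1 := by
      filter_upwards [hψm'.ae hψ, ψ.right_inv] with z hz hz'
      rw [← hz, hz']
    filter_upwards [hψ, hψm.ae (P.measurePreserving_invFun.quasiMeasurePreserving.ae h1)]
      with x hx hx'
    have e1 : a (V.invFun x) = a (P.invFun (ψ.toFun x)).1 := congrArg Prod.fst hx'
    have e2 : a (T'.invFun (ψ.toFun x).1) = a (T'.invFun x) := congrArg Prod.snd hx
    exact e1.trans e2

end InvTransf

/-! ### Conjugating extensions up to small measure. -/

namespace Extends

open InvTransf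

theorem mul {T S : GSquare} {T' S' : GInterval} (hT : Extends T T') (hS : Extends S S') :
    Extends (T * S) (T' * S') := by
  filter_upwards [S.measurePreserving_toFun.quasiMeasurePreserving.ae hT, hS] with z h1 h2
  exact h1.trans (congrArg T'.toFun h2)

theorem inv {T : GSquare} {T' : GInterval} (hT : Extends T T') : Extends T⁻¹ T'⁻¹ := by
  have hm := T.measurePreserving_invFun.quasiMeasurePreserving
  filter_upwards [hm.ae hT, hm.ae (Measure.quasiMeasurePreserving_fst.ae T'.left_inv),
    T.right_inv] with z h1 h2 h3
  change (T.invFun z).1 = T'.invFun z.1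
  rw [h3] at h1
  rw [h1, h2]

theorem prodMap (T U : GInterval) : Extends (InvTransf.prodMap T U) T :=
  .of_forall fun _ => rfl

theorem conjSeq {A Φ B : GSquare} {A' Φ' B' : GInterval} (hA : Extends A A')
    (hΦ : Extends Φ Φ') (hB : Extends B B') (j : ℕ) :
    Extends (conjSeq A Φ B j) (conjSeq A' Φ' B' j) := by
  induction j with
  | zero => exact hΦ
  | succ j ih => exact (hA.mul ih).mul hB.inv

/-- Two extensions of antiperiodic transformations are conjugate in `𝒢_X` up to a set of small
measure. -/
theorem exists_conj_eq_off_small {T₁ T₀ : GSquare} {T₁' T₀' : GInterval} (h₁ : Extends T₁ T₁')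
    (h₀ : Extends T₀ T₀') (ha₁ : T₁'.Antiperiodic) (ha₀ : T₀'.Antiperiodic) {n : ℕ}
    (hn : 0 < n) :
    ∃ S ∈ GX, (volume : Measure (I × I)).real
      {z | (S⁻¹ * T₀ * S).invFun z ≠ T₁.invFun z} ≤ 2 / (n + 1) := by
  obtain ⟨p, hp, hpn, hpT, hpμ⟩ := ha₁.exists_tower hn
  obtain ⟨q, hq, hqn, hqT, hqμ⟩ := ha₀.exists_tower hn
  obtain ⟨φ, hφ⟩ := AEIso.exists_of_measure_fiber_eq (volume : Measure I) (volume : Measure I)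
    hp hq (fun j => by
      by_cases hj : j ≤ n
      · rw [← measureReal_eq_measureReal_iff, hpμ j hj, hqμ j hj]
      · have h1 : p ⁻¹' {j} = ∅ :=
          Set.eq_empty_of_forall_notMem fun x hx => hj ((hx : p x = j) ▸ hpn x)
        have h2 : q ⁻¹' {j} = ∅ :=
          Set.eq_empty_of_forall_notMem fun x hx => hj ((hx : q x = j) ▸ hqn x)
        rw [h1, h2, measure_empty])
  set Φ' : GInterval := φ.toInvTransf
  set Φ : GSquare := InvTransf.prodMap Φ' 1
  have hΦ : Extends Φ Φ' := prodMap Φ' 1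
  -- Over the remainder, label `n`, any extension matching the remainders would do; `Φ` is one.
  set R : ℕ → GSquare := fun j => if j < n then InvTransf.conjSeq T₀ Φ T₁ j else Φ
  set R' : ℕ → GInterval := fun j => if j < n then InvTransf.conjSeq T₀' Φ' T₁' j else Φ'
  have hRR' : ∀ j, Extends (R j) (R' j) := by
    intro j
    by_cases hj : j < n
    · simp only [R, R', if_pos hj]; exact h₀.conjSeq hΦ h₁ j
    · simp only [R, R', if_neg hj]; exact hΦ
  have hR' : ∀ j, ∀ᵐ x : I, q (R' j x) = j ↔ p x = j := by
    intro j
    by_cases hj : j < n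
    · simp only [R', if_pos hj]; exact conjSeq_label hpT hqT hφ j hj
    · simp only [R', if_neg hj]
      filter_upwards [hφ] with x hx using (by rw [← hx]; rfl)
  have hR : ∀ j, ∀ᵐ z : I × I, q (R j z).1 = j ↔ p z.1 = j := by
    intro j
    filter_upwards [hRR' j, Measure.quasiMeasurePreserving_fst.ae (hR' j)] with z hz hz'
    rw [hz]; exact hz'
  obtain ⟨S', hS'⟩ := exists_glue R' hp hq hR'
  obtain ⟨S, hS⟩ := exists_glue R (hp.comp measurable_fst) (hq.comp measurable_fst) hR
  have hSS' : Extends S S' := by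
    filter_upwards [ae_all_iff.2 hRR'] with z hz
    rw [hS, hS', ← hz]; rfl
  refine ⟨S, ⟨S', hSS'⟩, ?_⟩
  have hm := T₁.measurePreserving_invFun.quasiMeasurePreserving
  -- Inverses are compared because images are preimages under the inverse. Descending a level is
  -- impossible only over the base and the remainder, hence the labels `0` and `n`.
  have key : ∀ᵐ z : I × I, p z.1 ≠ 0 → p z.1 ≠ n →
      (S⁻¹ * T₀ * S).invFun z = T₁.invFun z := by
    have hlab : ∀ᵐ z : I × I, ∀ j, j + 1 < n → (p (T₁' z.1) = j + 1 ↔ p z.1 = j) := by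
      refine ae_all_iff.2 fun j => ?_
      by_cases hj : j + 1 < n
      · filter_upwards [Measure.quasiMeasurePreserving_fst.ae (hpT j hj)] with z hz _ using hz
      · exact .of_forall fun z h => absurd h hj
    have hT₀ : ∀ᵐ z : I × I, ∀ j, T₀.invFun (T₀.toFun (R j (T₁.invFun z))) = R j (T₁.invFun z) :=
      ae_all_iff.2 fun j => hm.ae
        ((R j).measurePreserving_toFun.quasiMeasurePreserving.ae T₀.left_inv)
    filter_upwards [hm.ae hlab, hm.ae h₁, T₁.right_inv, hT₀, hm.ae S.left_inv]
      with z e1 e2 e3 e4 e5 hz0 hzn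
    obtain ⟨j, hj⟩ := Nat.exists_eq_succ_of_ne_zero hz0
    have hjn : j + 1 < n := by have := hpn z.1; omega
    rw [e3] at e2
    have hpj : p (T₁.invFun z).1 = j := (e1 j hjn).1 (by rw [← e2, hj])
    have a1 : S.toFun z = T₀.toFun (R j (T₁.invFun z)) := by
      have : R (j + 1) z = T₀.toFun (R j (T₁.invFun z)) := by
        simp only [R, if_pos hjn, if_pos (show j < n by omega)]; rfl
      rw [← this]
      have := hS z
      simp only [Function.comp_apply, hj] at this
      exact this
    have a2 : S.toFun (T₁.invFun z) = R j (T₁.invFun z) := by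
      have := hS (T₁.invFun z)
      simp only [Function.comp_apply, hpj] at this
      exact this
    change S.invFun (T₀.invFun (S.toFun z)) = _
    rw [a1, e4, ← a2, e5]
  have hmeas : ∀ j ≤ n, (volume : Measure (I × I)).real {z | p z.1 = j} = 1 / (n + 1) := by
    intro j hj
    rw [← hpμ j hj]
    exact (measurePreserving_fst (μ := (volume : Measure I))
      (ν := (volume : Measure I))).measureReal_preimage
      (hp (measurableSet_singleton j)).nullMeasurableSet
  have hsub : {z | (S⁻¹ * T₀ * S).invFun z ≠ T₁.invFun z} ≤ᵐ[(volume : Measure (I × I))]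
      ({z | p z.1 = 0} ∪ {z | p z.1 = n} : Set (I × I)) := by
    filter_upwards [key] with z hz hne
    by_contra hcon
    exact hne (hz (fun h => hcon (Or.inl h)) (fun h => hcon (Or.inr h)))
  calc _ ≤ (volume : Measure (I × I)).real ({z | p z.1 = 0} ∪ {z | p z.1 = n}) :=
        ENNReal.toReal_mono (measure_ne_top _ _) (measure_mono_ae hsub)
    _ ≤ _ := measureReal_union_le _ _
    _ = 2 / (n + 1) := by rw [hmeas 0 (Nat.zero_le _), hmeas n le_rfl]; ring

end Extends

/-! ### Dyadic sets and the conclusion. -/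

theorem measurableSet_dyadicInterval (k i : ℕ) : MeasurableSet (dyadicInterval k i) :=
  (measurableSet_le measurable_const measurable_subtype_coe).inter
    (measurableSet_le measurable_subtype_coe measurable_const)

/-- Membership in finitely many dyadic sets depends on the first coordinate only through its
membership in finitely many measurable sets. -/
theorem exists_finite_family_of_isDyadicSet {N : ℕ} {D : Fin N → Set (I × I)}
    (hD : ∀ i, IsDyadicSet (D i)) :
    ∃ (J : Type) (_ : Finite J) (A : J → Set I), (∀ j, MeasurableSet (A j)) ∧
      ∀ i x x' y, (∀ j, x ∈ A j ↔ x' ∈ A j) → ((x, y) ∈ D i ↔ (x', y) ∈ D i) := by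
  choose F hF hFQ hDF using hD
  have : ∀ Q : (Σ i, F i), ∃ A : Set I, MeasurableSet A ∧ ∃ B : Set I, Q.2.1 = A ×ˢ B := by
    rintro ⟨i, Q, hQ⟩
    obtain ⟨k, a, b, -, -, h⟩ := hFQ i Q hQ
    exact ⟨_, measurableSet_dyadicInterval k a, _, h⟩
  choose A hA B hAB using this
  have hfin : ∀ i, Finite (F i) := fun i => (hF i).to_subtype
  refine ⟨Σ i, F i, inferInstance, A, hA, fun i x x' y h => ?_⟩
  rw [hDF i]
  refine exists_congr fun Q => and_congr_right fun hQ => ?_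
  have := hAB ⟨i, Q, hQ⟩
  simp only at this
  rw [this, Set.mem_prod, Set.mem_prod, h]

/-- Every element of `𝒢_X` agrees on given dyadic sets with an extension of an antiperiodic
transformation. -/
theorem Extends.exists_antiperiodic {T : GSquare} {T' U : GInterval} (hT : Extends T T')
    (hU : U.Antiperiodic) {N : ℕ} {D : Fin N → Set (I × I)} (hD : ∀ i, IsDyadicSet (D i)) :
    ∃ (T₁ : GSquare) (V : GInterval), Extends T₁ V ∧ V.Antiperiodic ∧
      ∀ᵐ z : I × I, ∀ i, T₁.invFun z ∈ D i ↔ T.invFun z ∈ D i := by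
  obtain ⟨J, _, A, hA, hDA⟩ := exists_finite_family_of_isDyadicSet hD
  have ha : Measurable fun (x : I) (j : J) => x ∈ A j :=
    measurable_pi_lambda _ fun j => measurable_mem.2 (hA j)
  obtain ⟨V, hV, hVa⟩ := T'.exists_antiperiodic_label_eq hU ha
  -- The inverse is `T⁻¹` followed by `V⁻¹ * T'` on the first coordinate, which preserves the cells
  -- of the partition and hence membership in each `D i`.
  refine ⟨T * InvTransf.prodMap (T'⁻¹ * V) 1, V, ?_, hV, ?_⟩
  · have h := hT.mul (Extends.prodMap (T'⁻¹ * V) 1)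
    have h' : ∀ᵐ x : I, T'.toFun (T'.invFun (V x)) = V x :=
      V.measurePreserving_toFun.quasiMeasurePreserving.ae T'.right_inv
    filter_upwards [h, Measure.quasiMeasurePreserving_fst.ae h'] with z h1 h2
    exact h1.trans h2
  · have h1 : ∀ᵐ x : I, ∀ j, V.invFun (T'.toFun x) ∈ A j ↔ x ∈ A j := by
      filter_upwards [T'.measurePreserving_toFun.quasiMeasurePreserving.ae hVa, T'.left_inv]
        with x hx hx' j
      rw [hx'] at hx
      exact iff_of_eq (congrFun hx j)
    filter_upwards [T.measurePreserving_invFun.quasiMeasurePreserving.ae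
      (Measure.quasiMeasurePreserving_fst.ae h1)] with z hz i
    exact hDA i _ _ _ hz

theorem mainTheorem5 (T T₀ : GSquare) (T₀' : GInterval)
    (hT : T ∈ GX) (hT₀ : Extends T₀ T₀') (hanti : T₀'.Antiperiodic)
    {N : ℕ} (D : Fin N → Set (I × I)) (hD : ∀ i, IsDyadicSet (D i))
    (ε : ℝ) (hε : 0 < ε) :
    ∃ S ∈ GX, S⁻¹ * T₀ * S ∈ weakNhd T D ε := by
  obtain ⟨T', hT'⟩ := hT
  -- `T₀'` itself serves as the auxiliary antiperiodic map.
  obtain ⟨T₁, V, hT₁, hV, hD₁⟩ := hT'.exists_antiperiodic hanti hD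
  -- Height `m + 1` gives an error of at most `2 / (m + 2) ≤ 2 / (m + 1) < ε`.
  obtain ⟨m, hm⟩ := exists_nat_one_div_lt (half_pos hε)
  obtain ⟨S, ⟨S', hS⟩, hle⟩ := hT₁.exists_conj_eq_off_small hT₀ hV hanti m.succ_pos
  refine ⟨S, ⟨S', hS⟩, ⟨_, (hS.inv.mul hT₀).mul hS⟩, fun i => ?_⟩
  have hsub : ((S⁻¹ * T₀ * S).image (D i) ∆ T.image (D i) : Set (I × I))
      ≤ᵐ[(volume : Measure (I × I))] {z | (S⁻¹ * T₀ * S).invFun z ≠ T₁.invFun z} := by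
    filter_upwards [hD₁] with z hz hmem heq
    have h : (S⁻¹ * T₀ * S).invFun z ∈ D i ↔ T.invFun z ∈ D i := by rw [heq]; exact hz i
    rcases hmem with ⟨h1, h2⟩ | ⟨h1, h2⟩
    · exact h2 (h.1 h1)
    · exact h2 (h.2 h1)
  calc _ ≤ _ := ENNReal.toReal_mono (measure_ne_top _ _) (measure_mono_ae hsub)
    _ ≤ _ := hle
    _ ≤ 2 * (1 / ((m : ℝ) + 1)) := by
      rw [mul_one_div]
      push_cast
      gcongr
      linarith
    _ < ε := by linarith
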